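/- Graphs are finite undirected graphs, self-loops and multiple edges being allowed. Each edge $i-j$ is replaced by two directed edges $i\to j$ and $j\to i$. For a random graph $G_n$ on $n$ nodes with degrees $D_1,\dots,D_n$ (a self-loop counts twice) let $L_n=\sum_i D_i$, which is the number of directed edges, and $$f_n(k)=\frac1n\sum_{i=1}^n \mathbf 1\{D_i=k\},\qquad f_n^*(k)=\frac1{L_n}\sum_{i=1}^n k\,\mathbf 1\{D_i=k\},\qquad \mathcal F_n^*(k)=F_n^*(k)+F_n^*(k-1),$$ where $F_n^*$ is the cumulative distribution function of $f_n^*$. Spearman's rho of $G_n$ (with uniform ranking) is $$\rho(G_n)=\frac{12\sum_{i\to j}R_*(i\to j)R^*(i\to j)-3L_n(L_n+1)^2}{L_n^3-L_n},$$ where $R_*(i\to j)=\#\{s\to t:\ D_s+U_{s\to t}\ge D_i+U_{i\to j}\}$, $R^*(i\to j)=\#\{s\to t:\ D_t+W_{s\to t}\ge D_j+W_{i\to j}\}$, and the $U_{i\to j},W_{i\to j}$ are uniform on $(0,1)$, independent of each other and of $G_n$. Its asymptotically equivalent form is $$\widetilde\rho(G_n)=\frac3{L_n}\sum_{i\to j}\mathcal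 F_n^*(D_i)\mathcal F_n^*(D_j)-3 .$$ For probability mass functions $f,f^*$ on $\{0,1,2,\dots\}$ and $\eta,\varepsilon>0$, a sequence of random graphs $G_n$ on $n$ nodes belongs to $\mathcal G_{\eta,\varepsilon}(f,f^*)$ if $\sum_k k^{1+\eta}f(k)<\infty$ and $\mathbb P(\Omega_n)\to1$ as $n\to\infty$, where $$\Omega_n=\Big\{\max\Big\{\sum_{k\ge0}\Big|\sum_{t=0}^k\big(f_n(t)-f(t)\big)\Big|,\ \sum_{k\ge0}|f_n^*(k)-f^*(k)|\Big\}\le n^{-\varepsilon}\Big\}.$$ **Corollary.** For any $-1<\rho<0$ and $\gamma>1$ there exist a probability mass function $f$ on $\{0,1,2,\dots\}$ with $f(k)>0$ for all $k$ and finite mean $\mu$, and its size-biased version $f^*(k)=kf(k)/\mu$, such that the cumulative distribution function $F$ of $f$ satisfies $1-F(x)=\mathcal L(x)x^{-\gamma}$ for all $x>0$ with a slowly varying function $\mathcal L$, and such that for all $\eta,\varepsilon>0$ and every sequence of random graphs $G_n\in\mathcal G_{\eta,\varepsilon}(f,f^*)$, with $\kappa=\min(\varepsilon,1/2)$, both $$\mathbb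 P\big(\widetilde\rho(G_n)>\rho\big)\ \ge\ 1-O\big(n^{-1+\kappa}+n^{-\varepsilon+3\kappa/4}+\mathbb P(\Omega_n^c)\big)$$ and $$\mathbb P\big(\rho(G_n)>\rho\big)\ \ge\ 1-O\big(n^{-1+\kappa}+n^{-\varepsilon+3\kappa/4}+\mathbb P(\Omega_n^c)\big)$$ as $n\to\infty$. -/

import Mathlib

open MeasureTheory ProbabilityTheory Filter Topology

noncomputable section

namespace SpearmanGraph

/-! ## Probability mass functions on the non-negative integers -/

/-- `f` is a probability mass function on the non-negative integers. -/
structure IsPMF (f : ℕ → ℝ) : Prop where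
  nonneg : ∀ k, 0 ≤ f k
  hasSum_one : HasSum f 1

/-- The cumulative distribution function `F(x) = ∑_{k ≤ x} f(k)`, for real `x`. -/
def cumDist (f : ℕ → ℝ) (x : ℝ) : ℝ :=
  if 0 ≤ x then ∑ k ∈ Finset.range (⌊x⌋₊ + 1), f k else 0

/-- The function `𝓕(k) = F(k) + F(k - 1)` of a mass function with distribution function `F`. -/
def midCdf (f : ℕ → ℝ) (k : ℕ) : ℝ := cumDist f (k : ℝ) + cumDist f ((k : ℝ) - 1)

/-- `fstar` is the size-biased version of `f`: `f` has a finite mean `m ≠ 0` and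
`fstar k = k f(k) / m`. -/
def IsSizeBiased (f fstar : ℕ → ℝ) : Prop :=
  ∃ m : ℝ, m ≠ 0 ∧ HasSum (fun k : ℕ => (k : ℝ) * f k) m ∧ ∀ k : ℕ, fstar k = (k : ℝ) * f k / m

/-- Slowly varying functions (at infinity). -/
structure IsSlowlyVarying (ℓ : ℝ → ℝ) : Prop where
  measurable : Measurable ℓ
  eventually_pos : ∀ᶠ x in atTop, 0 < ℓ x
  tendsto_ratio : ∀ t : ℝ, 0 < t → Tendsto (fun x => ℓ (t * x) / ℓ x) atTop (𝓝 1)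

/-- The distribution with mass function `f` is regularly varying with tail exponent `γ`:
`1 - F(x) = ℓ(x) x ^ (-γ)` with `ℓ` slowly varying. -/
def HasRegularlyVaryingTail (f : ℕ → ℝ) (γ : ℝ) : Prop :=
  ∃ ℓ : ℝ → ℝ, IsSlowlyVarying ℓ ∧ ∀ x : ℝ, 0 < x → 1 - cumDist f x = ℓ x * x ^ (-γ)

/-! ## Graphs -/

/-- A finite undirected graph on `n` labelled nodes, in which self-loops and multiple edges are
allowed: the number of edges between each unordered pair of nodes. -/
abbrev Multigraph (n : ℕ) : Type := Sym2 (Fin n) → ℕ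

variable {n : ℕ}

/-- The number of directed edges `i → j` in the bi-directed version of the graph, in which each
edge `i - j` is replaced by the two edges `i → j` and `j → i` (so a self-loop gives two
directed edges `i → i`). -/
def arcCount (g : Multigraph n) (i j : Fin n) : ℕ :=
  if i = j then 2 * g s(i, j) else g s(i, j)

/-- The degree of a node (a self-loop counts twice). -/
def degree (g : Multigraph n) (i : Fin n) : ℕ := ∑ j, arcCount g i j

/-- The sum `L_n` of the degrees, equal to the number of directed edges. -/
def totalDegree (g : Multigraph n) : ℕ := ∑ i, degree g i

/-- The empirical degree distribution `f_n`. -/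
def empDegree (g : Multigraph n) (k : ℕ) : ℝ :=
  (1 / (n : ℝ)) * ∑ i, if degree g i = k then (1 : ℝ) else 0

/-- The empirical size-biased degree distribution `f_n^*`. -/
def empSizeBiased (g : Multigraph n) (k : ℕ) : ℝ :=
  (1 / (totalDegree g : ℝ)) * ∑ i, if degree g i = k then (k : ℝ) else 0

/-! ## Spearman's rho on a graph -/

/-- Spearman's rho in the form `(3 / L_n) ∑_{i → j} 𝓕_n^*(D_i) 𝓕_n^*(D_j) - 3`. -/
def rhoTilde (g : Multigraph n) : ℝ :=
  (3 / (totalDegree g : ℝ)) *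
    (∑ i, ∑ j, (arcCount g i j : ℝ) *
      (midCdf (empSizeBiased g) (degree g i) * midCdf (empSizeBiased g) (degree g j))) - 3

/-- The directed edges of the bi-directed version of a graph: the pair `(i, j)` of end points,
and a number that distinguishes parallel edges. -/
abbrev Arc (g : Multigraph n) : Type := (p : Fin n × Fin n) × Fin (arcCount g p.1 p.2)

/-- The tail `i` of the directed edge `i → j`. -/
def Arc.tail {g : Multigraph n} (e : Arc g) : Fin n := e.1.1

/-- The head `j` of the directed edge `i → j`. -/
def Arc.head {g : Multigraph n} (e : Arc g) : Fin n := e.1.2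

open scoped Classical in
/-- The rank `#{e' : x e ≤ x e'}` of `e` with respect to the values `x`. -/
def arcRank {g : Multigraph n} (x : Arc g → ℝ) (e : Arc g) : ℝ :=
  ∑ e' : Arc g, if x e' ≥ x e then (1 : ℝ) else 0

/-- Spearman's rho with uniform ranking,
`(12 ∑_e R_*(e) R^*(e) - 3 L_n (L_n + 1)^2) / (L_n^3 - L_n)`, where `R_*` and `R^*` are the ranks
of the degrees at the tails and at the heads of the directed edges, and ties are broken by adding
the numbers `u e` and `w e`, respectively. -/
def rho (g : Multigraph n) (u w : Arc g → ℝ) : ℝ :=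
  (12 * (∑ e : Arc g,
      arcRank (fun a => (degree g a.tail : ℝ) + u a) e *
        arcRank (fun a => (degree g a.head : ℝ) + w a) e)
    - 3 * (totalDegree g : ℝ) * ((totalDegree g : ℝ) + 1) ^ 2)
  / ((totalDegree g : ℝ) ^ 3 - (totalDegree g : ℝ))

/-- The labels `(i, j, a)` of potential directed edges on `n` nodes: the `a`-th edge `i → j`. -/
abbrev ArcLabel (n : ℕ) : Type := Fin n × Fin n × ℕ

/-- The label of a directed edge. -/
def Arc.label {g : Multigraph n} (e : Arc g) : ArcLabel n := (e.1.1, e.1.2, (e.2 : ℕ))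

/-- `U` and `W` attach to each potential directed edge two random variables with the uniform
distribution on `(0, 1)`; all of these are independent of each other and of the
random graph `G`. -/
structure IsUniformTieBreaking {Ω : Type*} [MeasurableSpace Ω] (P : Measure Ω)
    (G : Ω → Multigraph n) (U W : ArcLabel n → Ω → ℝ) : Prop where
  measurable_left : ∀ e, Measurable (U e)
  measurable_right : ∀ e, Measurable (W e)
  uniform_left : ∀ e, P.map (U e) = volume.restrict (Set.Ioo (0 : ℝ) 1)
  uniform_right : ∀ e, P.map (W e) = volume.restrict (Set.Ioo (0 : ℝ) 1)
  indep : iIndepFun (Sum.elim U W) P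
  indep_graph : IndepFun G (fun ω e => Sum.elim U W e ω) P

/-! ## Sequences of random graphs with given limiting degree distributions -/

/-- The set of graphs `g` on `n` nodes with
`max (∑_k |∑_{t ≤ k} (f_n(t) - f(t))|) (∑_k |f_n^*(k) - f^*(k)|) ≤ n ^ (-ε)`. -/
def closeSet (f fstar : ℕ → ℝ) (ε : ℝ) (n : ℕ) : Set (Multigraph n) :=
  {g | max
      (∑' k : ℕ, ENNReal.ofReal |∑ t ∈ Finset.range (k + 1), (empDegree g t - f t)|)
      (∑' k : ℕ, ENNReal.ofReal |empSizeBiased g k - fstar k|)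
      ≤ ENNReal.ofReal ((n : ℝ) ^ (-ε))}

/-- The sequence of random graphs `G n` on `n` nodes (each defined on a probability space of its
own) belongs to the class `𝒢_{η,ε}(f, f^*)`: the mass function `f` has a finite moment of order
`1 + η`, and the events `Ω_n = {G n ∈ closeSet f fstar ε n}` have probabilities tending to `1`. -/
structure InGraphClass (η ε : ℝ) (f fstar : ℕ → ℝ) {Ω : ℕ → Type*}
    [∀ n, MeasurableSpace (Ω n)] (P : ∀ n, Measure (Ω n))
    (G : ∀ n, Ω n → Multigraph n) : Prop where
  isPMF : IsPMF f
  isPMF_star : IsPMF fstar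
  eta_pos : 0 < η
  eps_pos : 0 < ε
  moment : Summable (fun k : ℕ => (k : ℝ) ^ (1 + η) * f k)
  measurable : ∀ n, Measurable (G n)
  tendsto_one : Tendsto (fun n => (P n).real {ω | G n ω ∈ closeSet f fstar ε n}) atTop (𝓝 1)

/-- The rate `n ^ (-1 + κ) + n ^ (-ε + 3 κ / 4) + P(Ω_n^c)` with `κ = min ε (1 / 2)`. -/
def errorRate (f fstar : ℕ → ℝ) (ε : ℝ) {Ω : ℕ → Type*} [∀ n, MeasurableSpace (Ω n)]
    (P : ∀ n, Measure (Ω n)) (G : ∀ n, Ω n → Multigraph n) (n : ℕ) : ℝ :=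
  (n : ℝ) ^ (-1 + min ε (1 / 2)) + (n : ℝ) ^ (-ε + 3 * min ε (1 / 2) / 4)
    + (P n).real {ω | G n ω ∉ closeSet f fstar ε n}

end SpearmanGraph

end

open SpearmanGraph

namespace SpearmanGraph

/-! ## Concordant triples of an independent family -/

/-! Take `f` whose size-biased version puts mass at least `1 - δ` at one. On `Ω_n`, whatever the
wiring of the graph, all but a fraction `O(δ)` of the arcs then join two nodes of degree one. These
arcs are tied at both ends and carry almost no correlation, so both versions of rho are at least
`-O(δ)`, up to lower-order terms for `rho`. The tail exponent is no obstacle: a power-law tail mixed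
in with a small weight `c` keeps its exponent (`exists_isSizeBiased_one_gt`).

For `rhoTilde` the bound is deterministic on `Ω_n` (`rhoTilde_ge`). For `rho` the tie-breaking
variables order the tied arcs. With `S` the set of arcs between nodes of degree one, `∑ R_* R^*` is
at least the number of concordant triples in `S` (`sum_concord_le_sum_arcRank`). That number has
mean at least `|S|^3 / 4` and variance `O(|S|^5)`, so Chebyshev's inequality makes a shortfall
`O(1/|S|) = O(1/n)` likely (`measureReal_sum_concord_lt_le`). Since `12 · 1/4 = 3`, the subtracted
term `3 L (L + 1)^2` is cancelled to leading order (`rho_gt`). Conditioning on the graph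
(`measureReal_mem_and_mem_le`) passes from fixed to random graphs. -/

/-- The indicator of `x ≤ y`. -/
noncomputable def leInd (x y : ℝ) : ℝ := if x ≤ y then 1 else 0

lemma leInd_nonneg (x y : ℝ) : 0 ≤ leInd x y := by
  unfold leInd; split_ifs <;> norm_num

lemma leInd_le_one (x y : ℝ) : leInd x y ≤ 1 := by
  unfold leInd; split_ifs <;> norm_num

lemma one_le_leInd_add (x y : ℝ) : 1 ≤ leInd x y + leInd y x := by
  unfold leInd
  rcases le_total x y with h | h
  · rw [if_pos h]; split_ifs <;> norm_num
  · rw [if_pos h]; split_ifs <;> norm_num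

lemma measurable_leInd : Measurable fun p : ℝ × ℝ => leInd p.1 p.2 :=
  Measurable.ite (measurableSet_le measurable_fst measurable_snd) measurable_const
    measurable_const

lemma measurable_leInd_comp {α : Type*} [MeasurableSpace α] {x y : α → ℝ}
    (hx : Measurable x) (hy : Measurable y) : Measurable fun a => leInd (x a) (y a) :=
  measurable_leInd.comp (hx.prodMk hy)

lemma measurable_leInd_apply {κ : Type*} (i j : κ) :
    Measurable fun v : κ → ℝ => leInd (v i) (v j) :=
  measurable_leInd_comp (measurable_pi_apply i) (measurable_pi_apply j)

/-- The indicator of the event that the `e`-th variables on the left and on the right are at most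
the `e'`-th on the left and the `e''`-th on the right, for `t = (e, e', e'')`. -/
noncomputable def concord {ι : Type*} (v : ι ⊕ ι → ℝ) (t : ι × ι × ι) : ℝ :=
  leInd (v (.inl t.1)) (v (.inl t.2.1)) * leInd (v (.inr t.1)) (v (.inr t.2.2))

lemma concord_nonneg {ι : Type*} (v : ι ⊕ ι → ℝ) (t : ι × ι × ι) : 0 ≤ concord v t :=
  mul_nonneg (leInd_nonneg _ _) (leInd_nonneg _ _)

lemma concord_le_one {ι : Type*} (v : ι ⊕ ι → ℝ) (t : ι × ι × ι) : concord v t ≤ 1 :=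
  mul_le_one₀ (leInd_le_one _ _) (leInd_nonneg _ _) (leInd_le_one _ _)

section Independent

variable {Ω ι : Type*} [MeasurableSpace Ω] {P : Measure Ω} [IsProbabilityMeasure P]
  {V : ι ⊕ ι → Ω → ℝ} {ν : Measure ℝ}

lemma measurable_concord (hV : ∀ i, Measurable (V i)) (t : ι × ι × ι) :
    Measurable fun ω => concord (fun i => V i ω) t :=
  (measurable_leInd_comp (hV _) (hV _)).mul (measurable_leInd_comp (hV _) (hV _))

lemma memLp_of_mem_unitInterval {X : Ω → ℝ} (hX : Measurable X) (h0 : ∀ ω, 0 ≤ X ω)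
    (h1 : ∀ ω, X ω ≤ 1) (p : ENNReal) : MemLp X p P :=
  MemLp.of_bound hX.aestronglyMeasurable 1 (.of_forall fun ω => by
    rw [Real.norm_eq_abs, abs_of_nonneg (h0 ω)]; exact h1 ω)

/-- Exchanging `i` and `j` preserves the joint law, and the two indicators add up to at least one.
Ties only help, so `ν` may have atoms. -/
lemma integral_leInd_ge {κ : Type*} {X : κ → Ω → ℝ} (hX : ∀ i, Measurable (X i))
    (hind : iIndepFun X P) (hlaw : ∀ i, P.map (X i) = ν) (i j : κ) :
    1 / 2 ≤ ∫ ω, leInd (X i ω) (X j ω) ∂P := by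
  by_cases hij : i = j
  · subst hij
    simp only [leInd, le_refl, if_true]
    norm_num
  have hint : ∀ i j, Integrable (fun ω => leInd (X i ω) (X j ω)) P := fun i j =>
    (memLp_of_mem_unitInterval (measurable_leInd_comp (hX i) (hX j))
      (fun _ => leInd_nonneg _ _) (fun _ => leInd_le_one _ _) 1).integrable le_rfl
  have hmap : ∀ i j, i ≠ j → ∫ ω, leInd (X i ω) (X j ω) ∂P
      = ∫ p : ℝ × ℝ, leInd p.1 p.2 ∂(ν.prod ν) := by
    intro i j hij
    have h := (indepFun_iff_map_prod_eq_prod_map_map (hX i).aemeasurable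
      (hX j).aemeasurable).1 (hind.indepFun hij)
    rw [hlaw i, hlaw j] at h
    rw [← h, integral_map ((hX i).prodMk (hX j)).aemeasurable
      measurable_leInd.aestronglyMeasurable]
  have hsum : (1 : ℝ) ≤ ∫ ω, (leInd (X i ω) (X j ω) + leInd (X j ω) (X i ω)) ∂P := by
    calc (1 : ℝ) = ∫ _, (1 : ℝ) ∂P := by simp
      _ ≤ _ := integral_mono (integrable_const _) ((hint i j).add (hint j i))
        fun ω => one_le_leInd_add _ _
  rw [integral_add (hint i j) (hint j i), hmap i j hij, hmap j i (Ne.symm hij)] at hsum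
  rw [hmap i j hij]
  linarith

/-- The left and right comparisons involve disjoint sets of variables, so the expectation factors
even if the triple has repeated members. -/
lemma integral_concord_ge (hV : ∀ i, Measurable (V i)) (hind : iIndepFun V P)
    (hlaw : ∀ i, P.map (V i) = ν) (t : ι × ι × ι) :
    1 / 4 ≤ ∫ ω, concord (fun i => V i ω) t ∂P := by
  classical
  have hdisj : Disjoint ({.inl t.1, .inl t.2.1} : Finset (ι ⊕ ι)) {.inr t.1, .inr t.2.2} := by
    simp
  have h := (hind.indepFun_finset _ _ hdisj hV).comp
    (φ := fun v => leInd (v ⟨.inl t.1, by simp⟩) (v ⟨.inl t.2.1, by simp⟩))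
    (ψ := fun v => leInd (v ⟨.inr t.1, by simp⟩) (v ⟨.inr t.2.2, by simp⟩))
    (measurable_leInd_apply _ _)
    (measurable_leInd_apply _ _)
  have hmul := h.integral_fun_mul_eq_mul_integral
    (measurable_leInd_comp (hV _) (hV _)).aestronglyMeasurable
    (measurable_leInd_comp (hV _) (hV _)).aestronglyMeasurable
  have h1 := integral_leInd_ge hV hind hlaw (.inl t.1) (.inl t.2.1)
  have h2 := integral_leInd_ge hV hind hlaw (.inr t.1) (.inr t.2.2)
  calc (1 / 4 : ℝ) = 1 / 2 * (1 / 2) := by norm_num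
    _ ≤ _ := mul_le_mul h1 h2 (by norm_num) (le_trans (by norm_num) h1)
    _ = _ := hmul.symm

/-- The members of a triple. -/
def tripleSupport [DecidableEq ι] (t : ι × ι × ι) : Finset ι := {t.1, t.2.1, t.2.2}

lemma covariance_concord_eq_zero [DecidableEq ι] (hV : ∀ i, Measurable (V i))
    (hind : iIndepFun V P) {t s : ι × ι × ι}
    (hts : Disjoint (tripleSupport t) (tripleSupport s)) :
    cov[fun ω => concord (fun i => V i ω) t, fun ω => concord (fun i => V i ω) s; P] = 0 := by
  have hdisj : Disjoint ((tripleSupport t).disjSum (tripleSupport t))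
      ((tripleSupport s).disjSum (tripleSupport s)) := by
    rw [Finset.disjoint_left] at hts ⊢
    rintro (a | a) ha hb
    · exact hts (Finset.inl_mem_disjSum.1 ha) (Finset.inl_mem_disjSum.1 hb)
    · exact hts (Finset.inr_mem_disjSum.1 ha) (Finset.inr_mem_disjSum.1 hb)
  have hmeas : ∀ t : ι × ι × ι, Measurable
      fun v : ((tripleSupport t).disjSum (tripleSupport t) : Finset (ι ⊕ ι)) → ℝ =>
        leInd (v ⟨.inl t.1, by simp [tripleSupport]⟩) (v ⟨.inl t.2.1, by simp [tripleSupport]⟩) *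
        leInd (v ⟨.inr t.1, by simp [tripleSupport]⟩) (v ⟨.inr t.2.2, by simp [tripleSupport]⟩) :=
    fun t => (measurable_leInd_apply _ _).mul
      (measurable_leInd_apply _ _)
  have h := (hind.indepFun_finset _ _ hdisj hV).comp (hmeas t) (hmeas s)
  exact h.covariance_eq_zero
    (memLp_of_mem_unitInterval (measurable_concord hV t) (fun _ => concord_nonneg _ _)
      (fun _ => concord_le_one _ _) 2)
    (memLp_of_mem_unitInterval (measurable_concord hV s) (fun _ => concord_nonneg _ _)
      (fun _ => concord_le_one _ _) 2)

lemma covariance_le_one {X Y : Ω → ℝ} (hX : Measurable X) (hY : Measurable Y)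
    (hX0 : ∀ ω, 0 ≤ X ω) (hX1 : ∀ ω, X ω ≤ 1) (hY0 : ∀ ω, 0 ≤ Y ω) (hY1 : ∀ ω, Y ω ≤ 1) :
    cov[X, Y; P] ≤ 1 := by
  rw [covariance_eq_sub (memLp_of_mem_unitInterval hX hX0 hX1 2)
    (memLp_of_mem_unitInterval hY hY0 hY1 2)]
  have h1 : ∫ ω, (X * Y) ω ∂P ≤ ∫ _, (1 : ℝ) ∂P :=
    integral_mono ((memLp_of_mem_unitInterval (hX.mul hY) (fun ω => mul_nonneg (hX0 ω) (hY0 ω))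
      (fun ω => mul_le_one₀ (hX1 ω) (hY0 ω) (hY1 ω)) 1).integrable le_rfl)
      (integrable_const _) fun ω => mul_le_one₀ (hX1 ω) (hY0 ω) (hY1 ω)
  have h2 : 0 ≤ (∫ ω, X ω ∂P) * ∫ ω, Y ω ∂P :=
    mul_nonneg (integral_nonneg hX0) (integral_nonneg hY0)
  simp only [integral_const, probReal_univ, smul_eq_mul, one_mul] at h1
  linarith

/-- A shared member can sit in one of three positions and take at most three values; the other two
positions are free. -/
lemma card_filter_not_disjoint_le [DecidableEq ι] (S : Finset ι) (t : ι × ι × ι) :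
    ((S ×ˢ S ×ˢ S).filter fun s => ¬ Disjoint (tripleSupport t) (tripleSupport s)).card
      ≤ 9 * S.card ^ 2 := by
  set A := tripleSupport t
  have hA : A.card ≤ 3 := Finset.card_le_three
  have hsub : ((S ×ˢ S ×ˢ S).filter fun s => ¬ Disjoint A (tripleSupport s))
      ⊆ (A ×ˢ S ×ˢ S) ∪ ((S ×ˢ A ×ˢ S) ∪ (S ×ˢ S ×ˢ A)) := by
    intro s hs
    simp only [Finset.mem_filter, Finset.mem_product, Finset.not_disjoint_iff, tripleSupport,
      Finset.mem_insert, Finset.mem_singleton] at hs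
    obtain ⟨⟨h1, h2, h3⟩, a, ha, rfl | rfl | rfl⟩ := hs <;>
      simp only [Finset.mem_union, Finset.mem_product] <;> tauto
  refine (Finset.card_le_card hsub).trans ((Finset.card_union_le _ _).trans
    ((Nat.add_le_add_left (Finset.card_union_le _ _) _).trans ?_))
  simp only [Finset.card_product]
  nlinarith [Nat.mul_le_mul_right (S.card ^ 2) hA]

/-- Disjoint triples are uncorrelated, so of the `|S|^6` covariances at most `9 |S|^5` contribute,
each at most one. -/
lemma variance_sum_concord_le (hV : ∀ i, Measurable (V i)) (hind : iIndepFun V P)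
    (S : Finset ι) :
    Var[fun ω => ∑ t ∈ S ×ˢ S ×ˢ S, concord (fun i => V i ω) t; P] ≤ 9 * (S.card : ℝ) ^ 5 := by
  classical
  rw [variance_fun_sum' (X := fun t ω => concord (fun i => V i ω) t) fun t _ =>
    memLp_of_mem_unitInterval (measurable_concord hV t)
    (fun _ => concord_nonneg _ _) (fun _ => concord_le_one _ _) 2]
  have hrow : ∀ t ∈ S ×ˢ S ×ˢ S, (∑ s ∈ S ×ˢ S ×ˢ S,
      cov[fun ω => concord (fun i => V i ω) t, fun ω => concord (fun i => V i ω) s; P])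
      ≤ 9 * (S.card : ℝ) ^ 2 := by
    intro t _
    calc _ ≤ ∑ s ∈ S ×ˢ S ×ˢ S,
          if ¬ Disjoint (tripleSupport t) (tripleSupport s) then (1 : ℝ) else 0 := by
          refine Finset.sum_le_sum fun s _ => ?_
          split_ifs with h
          · exact (covariance_concord_eq_zero hV hind h).le
          · exact covariance_le_one (measurable_concord hV t) (measurable_concord hV s)
              (fun _ => concord_nonneg _ _) (fun _ => concord_le_one _ _)
              (fun _ => concord_nonneg _ _) (fun _ => concord_le_one _ _)
      _ = (((S ×ˢ S ×ˢ S).filter fun s =>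
            ¬ Disjoint (tripleSupport t) (tripleSupport s)).card : ℝ) := by
          rw [Finset.sum_boole]
      _ ≤ 9 * (S.card : ℝ) ^ 2 := by exact_mod_cast card_filter_not_disjoint_le S t
  refine (Finset.sum_le_card_nsmul _ _ _ hrow).trans (le_of_eq ?_)
  simp only [Finset.card_product, nsmul_eq_mul, Nat.cast_mul]
  ring

/-- The number of concordant triples falls below `(1/4 - α) |S|^3` with probability
`O(1 / |S|)`. -/
lemma measureReal_sum_concord_lt_le (hV : ∀ i, Measurable (V i)) (hind : iIndepFun V P)
    (hlaw : ∀ i, P.map (V i) = ν) (S : Finset ι) (hS : 0 < S.card) {α : ℝ} (hα : 0 < α) :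
    P.real {ω | ∑ t ∈ S ×ˢ S ×ˢ S, concord (fun i => V i ω) t < (1 / 4 - α) * (S.card : ℝ) ^ 3}
      ≤ 9 / (α ^ 2 * S.card) := by
  set X : Ω → ℝ := fun ω => ∑ t ∈ S ×ˢ S ×ˢ S, concord (fun i => V i ω) t with hX
  have hm : (0 : ℝ) < S.card := by exact_mod_cast hS
  have hLp : ∀ t, MemLp (fun ω => concord (fun i => V i ω) t) 2 P := fun t =>
    memLp_of_mem_unitInterval (measurable_concord hV t)
      (fun _ => concord_nonneg _ _) (fun _ => concord_le_one _ _) 2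
  have hXLp : MemLp X 2 P := memLp_finsetSum _ fun t _ => hLp t
  have hmean : 1 / 4 * (S.card : ℝ) ^ 3 ≤ ∫ ω, X ω ∂P := by
    rw [hX, integral_finsetSum _ fun t _ => (hLp t).integrable (by norm_num)]
    refine le_trans (le_of_eq ?_)
      (Finset.card_nsmul_le_sum _ _ (1 / 4) fun t _ => integral_concord_ge hV hind hlaw t)
    simp only [Finset.card_product, nsmul_eq_mul, Nat.cast_mul]
    ring
  have hc : 0 < α * (S.card : ℝ) ^ 3 := by positivity
  have hcheb := meas_ge_le_variance_div_sq hXLp hc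
  have hsub : {ω | X ω < (1 / 4 - α) * (S.card : ℝ) ^ 3}
      ⊆ {ω | α * (S.card : ℝ) ^ 3 ≤ |X ω - ∫ x, X x ∂P|} := by
    intro ω hω
    simp only [Set.mem_ofPred_eq] at hω ⊢
    rw [le_abs]
    right
    linarith
  have h1 : P.real {ω | X ω < (1 / 4 - α) * (S.card : ℝ) ^ 3}
      ≤ Var[X; P] / (α * (S.card : ℝ) ^ 3) ^ 2 :=
    ENNReal.toReal_le_of_le_ofReal (div_nonneg (variance_nonneg _ _) (sq_nonneg _))
      ((measure_mono hsub).trans hcheb)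
  refine h1.trans ?_
  calc Var[X; P] / (α * (S.card : ℝ) ^ 3) ^ 2
      ≤ 9 * (S.card : ℝ) ^ 5 / (α * (S.card : ℝ) ^ 3) ^ 2 := by
        gcongr
        exact variance_sum_concord_le hV hind S
    _ = 9 / (α ^ 2 * S.card) := by field_simp

end Independent

/-! ## Arcs between nodes of degree one -/

lemma sum_arc {n : ℕ} (g : Multigraph n) (φ : Fin n → Fin n → ℝ) :
    ∑ e : Arc g, φ e.tail e.head = ∑ i, ∑ j, (arcCount g i j : ℝ) * φ i j := by
  rw [Fintype.sum_sigma, Fintype.sum_prod_type]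
  simp [Arc.tail, Arc.head]

lemma arcCount_comm {n : ℕ} (g : Multigraph n) (i j : Fin n) :
    arcCount g i j = arcCount g j i := by
  unfold arcCount
  rw [Sym2.eq_swap]
  simp only [eq_comm]

lemma sum_arc_tail {n : ℕ} (g : Multigraph n) (φ : Fin n → ℝ) :
    ∑ e : Arc g, φ e.tail = ∑ i, (degree g i : ℝ) * φ i := by
  rw [sum_arc g fun i _ => φ i]
  simp [degree, Finset.sum_mul]

lemma sum_arc_head {n : ℕ} (g : Multigraph n) (φ : Fin n → ℝ) :
    ∑ e : Arc g, φ e.head = ∑ i, (degree g i : ℝ) * φ i := by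
  rw [sum_arc g fun _ j => φ j, Finset.sum_comm]
  refine Finset.sum_congr rfl fun i _ => ?_
  simp [degree, Finset.sum_mul, arcCount_comm g i]

lemma sum_arc_one {n : ℕ} (g : Multigraph n) : ∑ _e : Arc g, (1 : ℝ) = totalDegree g := by
  rw [sum_arc_tail g fun _ => 1]
  simp [totalDegree]

/-- The arcs whose two end points have degree one. -/
def unitArcs {n : ℕ} (g : Multigraph n) : Finset (Arc g) :=
  Finset.univ.filter fun e => degree g e.tail = 1 ∧ degree g e.head = 1

lemma totalDegree_mul_empSizeBiased {n : ℕ} (g : Multigraph n) (hL : 0 < totalDegree g) :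
    (totalDegree g : ℝ) * empSizeBiased g 1 = ∑ i, (degree g i : ℝ) *
      (if degree g i = 1 then 1 else 0) := by
  have : (totalDegree g : ℝ) ≠ 0 := by exact_mod_cast hL.ne'
  unfold empSizeBiased
  rw [← mul_assoc, mul_one_div_cancel this, one_mul]
  refine Finset.sum_congr rfl fun i _ => ?_
  split_ifs with h <;> simp [h]

/-- Inclusion-exclusion: a fraction `empSizeBiased g 1` of the arcs has a tail of degree one, and
the same fraction has such a head. -/
lemma le_card_unitArcs {n : ℕ} (g : Multigraph n) (hL : 0 < totalDegree g) :
    (2 * empSizeBiased g 1 - 1) * totalDegree g ≤ (unitArcs g).card := by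
  have htail := sum_arc_tail g fun i => if degree g i = 1 then 1 else 0
  have hhead := sum_arc_head g fun i => if degree g i = 1 then 1 else 0
  have hone := sum_arc_one g
  rw [← totalDegree_mul_empSizeBiased g hL] at htail hhead
  have : ((unitArcs g).card : ℝ)
      = ∑ e : Arc g, if degree g e.tail = 1 ∧ degree g e.head = 1 then 1 else 0 := by
    rw [Finset.sum_boole, unitArcs]
  rw [this]
  calc (2 * empSizeBiased g 1 - 1) * totalDegree g
      = ∑ e : Arc g, (((if degree g e.tail = 1 then (1 : ℝ) else 0)
        + (if degree g e.head = 1 then 1 else 0)) - 1) := by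
        rw [Finset.sum_sub_distrib, Finset.sum_add_distrib, htail, hhead, hone]; ring
    _ ≤ _ := by
        refine Finset.sum_le_sum fun e _ => ?_
        by_cases h1 : degree g e.tail = 1 <;> by_cases h2 : degree g e.head = 1 <;> simp [h1, h2]

lemma cumDist_nonneg {f : ℕ → ℝ} (hf : ∀ k, 0 ≤ f k) (x : ℝ) : 0 ≤ cumDist f x := by
  unfold cumDist
  split_ifs
  · exact Finset.sum_nonneg fun k _ => hf k
  · exact le_rfl

lemma empSizeBiased_nonneg {n : ℕ} (g : Multigraph n) (k : ℕ) : 0 ≤ empSizeBiased g k := by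
  unfold empSizeBiased
  refine mul_nonneg (by positivity) (Finset.sum_nonneg fun i _ => ?_)
  split_ifs <;> positivity

lemma midCdf_nonneg {f : ℕ → ℝ} (hf : ∀ k, 0 ≤ f k) (k : ℕ) : 0 ≤ midCdf f k :=
  add_nonneg (cumDist_nonneg hf _) (cumDist_nonneg hf _)

lemma le_midCdf {f : ℕ → ℝ} (hf : ∀ k, 0 ≤ f k) (k : ℕ) : f k ≤ midCdf f k := by
  refine le_add_of_le_of_nonneg ?_ (cumDist_nonneg hf _)
  rw [cumDist, if_pos k.cast_nonneg, Nat.floor_natCast]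
  exact Finset.single_le_sum (fun i _ => hf i) (by simp)

/-- All summands are nonnegative, so only the arcs in `unitArcs g` are kept; on these both factors
are at least `f_n^*(1) ≥ 1 - δ`. -/
lemma rhoTilde_ge {n : ℕ} (g : Multigraph n) (hL : 0 < totalDegree g)
    {δ : ℝ} (hδ1 : δ ≤ 1 / 2) (hs : 1 - δ ≤ empSizeBiased g 1) :
    3 * (1 - 2 * δ) * (1 - δ) ^ 2 - 3 ≤ rhoTilde g := by
  have hL' : (0 : ℝ) < totalDegree g := by exact_mod_cast hL
  have hcard := le_card_unitArcs g hL
  have hnn := empSizeBiased_nonneg g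
  have hsum : (1 - 2 * δ) * totalDegree g * (1 - δ) ^ 2 ≤
      ∑ i, ∑ j, (arcCount g i j : ℝ) *
      (midCdf (empSizeBiased g) (degree g i) * midCdf (empSizeBiased g) (degree g j)) := by
    rw [← sum_arc g fun i j =>
      midCdf (empSizeBiased g) (degree g i) * midCdf (empSizeBiased g) (degree g j)]
    calc (1 - 2 * δ) * totalDegree g * (1 - δ) ^ 2
        ≤ (unitArcs g).card * (1 - δ) ^ 2 := by
          refine mul_le_mul_of_nonneg_right (le_trans ?_ hcard) (sq_nonneg _)
          exact mul_le_mul_of_nonneg_right (by linarith) hL'.le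
      _ = ∑ _e ∈ unitArcs g, (1 - δ) ^ 2 := by simp
      _ ≤ ∑ e ∈ unitArcs g, midCdf (empSizeBiased g) (degree g e.tail) *
          midCdf (empSizeBiased g) (degree g e.head) := by
          refine Finset.sum_le_sum fun e he => ?_
          obtain ⟨h1, h2⟩ := (Finset.mem_filter.1 he).2
          have h := hs.trans (le_midCdf hnn 1)
          rw [h1, h2, sq]
          exact mul_le_mul h h (by linarith) (midCdf_nonneg hnn _)
      _ ≤ _ := Finset.sum_le_sum_of_subset_of_nonneg (Finset.subset_univ _) fun e _ _ =>
          mul_nonneg (midCdf_nonneg hnn _) (midCdf_nonneg hnn _)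
  unfold rhoTilde
  rw [sub_le_sub_iff_right, div_mul_eq_mul_div, le_div_iff₀ hL']
  linarith

/-- Arcs and competitors are both restricted to `unitArcs g`. There all degrees equal one and
cancel, leaving comparisons of tie-breakers; the product of the two rank sums expands into triples.
-/
lemma sum_concord_le_sum_arcRank {n : ℕ} (g : Multigraph n) (u w : Arc g → ℝ) :
    ∑ t ∈ unitArcs g ×ˢ unitArcs g ×ˢ unitArcs g, concord (Sum.elim u w) t ≤
    ∑ e : Arc g, arcRank (fun a => (degree g a.tail : ℝ) + u a) e *
        arcRank (fun a => (degree g a.head : ℝ) + w a) e := by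
  classical
  have hrank_nonneg : ∀ (x : Arc g → ℝ) e, 0 ≤ arcRank x e := fun x e =>
    Finset.sum_nonneg fun _ _ => by split_ifs <;> norm_num
  have hrank : ∀ (d : Arc g → ℕ) (x : Arc g → ℝ), (∀ e ∈ unitArcs g, d e = 1) →
      ∀ e ∈ unitArcs g, ∑ e' ∈ unitArcs g, leInd (x e) (x e')
        ≤ arcRank (fun a => (d a : ℝ) + x a) e := by
    intro d x hd e he
    unfold arcRank
    refine le_trans (Finset.sum_le_sum fun e' he' => ?_)
      (Finset.sum_le_sum_of_subset_of_nonneg (Finset.subset_univ (unitArcs g)) fun _ _ _ => by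
        split_ifs <;> norm_num)
    simp [leInd, hd e he, hd e' he']
  calc _ = ∑ e ∈ unitArcs g, (∑ e' ∈ unitArcs g, leInd (u e) (u e')) *
        ∑ e'' ∈ unitArcs g, leInd (w e) (w e'') := by
        simp only [Finset.sum_product, Finset.sum_mul_sum, concord, Sum.elim_inl, Sum.elim_inr]
    _ ≤ ∑ e ∈ unitArcs g, arcRank (fun a => (degree g a.tail : ℝ) + u a) e *
        arcRank (fun a => (degree g a.head : ℝ) + w a) e := by
        refine Finset.sum_le_sum fun e he => mul_le_mul
          (hrank (fun a => degree g a.tail) u (fun e he => (Finset.mem_filter.1 he).2.1) e he)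
          (hrank (fun a => degree g a.head) w (fun e he => (Finset.mem_filter.1 he).2.2) e he)
          (Finset.sum_nonneg fun _ _ => leInd_nonneg _ _) (hrank_nonneg _ _)
    _ ≤ _ := Finset.sum_le_sum_of_subset_of_nonneg (Finset.subset_univ _) fun e _ _ =>
          mul_nonneg (hrank_nonneg _ _) (hrank_nonneg _ _)

/-- If most arcs join nodes of degree one and few of their triples are discordant, then Spearman's
rho is at least slightly negative. -/
lemma rho_gt {n : ℕ} (g : Multigraph n) (u w : Arc g → ℝ) {r : ℝ} (hr : 0 < r) (hr1 : r < 1)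
    (hL : 20 / r < totalDegree g) (hs : 1 - r / 100 ≤ empSizeBiased g 1)
    (hX : (1 / 4 - r / 100) * ((unitArcs g).card : ℝ) ^ 3 ≤
      ∑ t ∈ unitArcs g ×ˢ unitArcs g ×ˢ unitArcs g, concord (Sum.elim u w) t) :
    -r < rho g u w := by
  have hL1 : (20 : ℝ) < totalDegree g := lt_of_le_of_lt ((le_div_iff₀ hr).2 (by linarith)) hL
  have hL0 : 0 < totalDegree g := by exact_mod_cast (by linarith : (0 : ℝ) < totalDegree g)
  have hsum := hX.trans (sum_concord_le_sum_arcRank g u w)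
  have hcard := le_card_unitArcs g hL0
  unfold rho
  set L : ℝ := (totalDegree g : ℝ)
  set R : ℝ := ∑ e : Arc g, arcRank (fun a => (degree g a.tail : ℝ) + u a) e *
        arcRank (fun a => (degree g a.head : ℝ) + w a) e
  have hrL : 20 < r * L := by rwa [div_lt_iff₀ hr, mul_comm] at hL
  have hm : (1 - r / 50) * L ≤ (unitArcs g).card :=
    le_trans (mul_le_mul_of_nonneg_right (by linarith) (by linarith)) hcard
  have hm3 : ((1 - r / 50) * L) ^ 3 ≤ ((unitArcs g).card : ℝ) ^ 3 :=
    pow_le_pow_left₀ (mul_nonneg (by linarith) (by linarith)) hm 3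
  have hcube : 1 - 3 * (r / 50) ≤ (1 - r / 50) ^ 3 := by
    have : 0 ≤ (r / 50) ^ 2 * (3 - r / 50) := mul_nonneg (sq_nonneg _) (by linarith)
    nlinarith
  -- To first order the right side is `3 - 0.12 r - 0.18 r`, leaving room below `r / 2`.
  have hcoef : 3 - r / 2 ≤ 12 * ((1 / 4 - r / 100) * (1 - r / 50) ^ 3) := by
    have := mul_le_mul_of_nonneg_left hcube (by linarith : 0 ≤ 1 / 4 - r / 100)
    nlinarith [sq_nonneg r]
  have hR : (3 - r / 2) * L ^ 3 ≤ 12 * R := by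
    have h1 := mul_le_mul_of_nonneg_left hm3 (by linarith : 0 ≤ 1 / 4 - r / 100)
    have h2 := mul_le_mul_of_nonneg_right hcoef (by positivity : 0 ≤ L ^ 3)
    rw [mul_pow] at h1
    linarith
  have hden : 0 < L ^ 3 - L := by
    have : L * 1 < L * L ^ 2 := mul_lt_mul_of_pos_left (by nlinarith) (by linarith)
    linarith
  rw [lt_div_iff₀ hden]
  -- Half of `r L ^ 3` remains to absorb the lower-order terms `6 L ^ 2 + 3 L + r L`.
  have h3 : 20 * L ^ 2 < r * L ^ 3 := by
    have := mul_lt_mul_of_pos_right hrL (by positivity : 0 < L ^ 2)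
    linarith
  have h4 : r * L < L := by nlinarith
  nlinarith

/-! ## A regularly varying distribution with most of its size-biased mass at one -/

/-- The mass function on the non-negative integers with tails `(k + 2) ^ (-γ)`. -/
noncomputable def zetaTailPMF (γ : ℝ) (k : ℕ) : ℝ :=
  ((k : ℝ) + 1) ^ (-γ) - ((k : ℝ) + 2) ^ (-γ)

lemma zetaTailPMF_pos {γ : ℝ} (hγ : 0 < γ) (k : ℕ) : 0 < zetaTailPMF γ k :=
  sub_pos.2 (Real.rpow_lt_rpow_of_neg (by positivity) (by linarith) (by linarith))

lemma sum_range_zetaTailPMF (γ : ℝ) (N : ℕ) :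
    ∑ k ∈ Finset.range N, zetaTailPMF γ k = 1 - ((N : ℝ) + 1) ^ (-γ) := by
  induction N with
  | zero => simp
  | succ N ih =>
    rw [Finset.sum_range_succ, ih, zetaTailPMF]
    push_cast
    rw [add_assoc (N : ℝ) 1 1, one_add_one_eq_two]
    ring

lemma hasSum_zetaTailPMF {γ : ℝ} (hγ : 0 < γ) : HasSum (zetaTailPMF γ) 1 := by
  rw [hasSum_iff_tendsto_nat_of_nonneg fun k => (zetaTailPMF_pos hγ k).le]
  simp only [sum_range_zetaTailPMF]
  have h : Tendsto (fun N : ℕ => ((N : ℝ) + 1) ^ (-γ)) atTop (𝓝 0) :=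
    (tendsto_rpow_neg_atTop hγ).comp
      (tendsto_atTop_add_const_right _ _ tendsto_natCast_atTop_atTop)
  simpa using h.const_sub 1

/-- Summation by parts: the partial means are partial sums of the tails, summable for `γ > 1`, minus
a nonnegative boundary term. -/
lemma summable_mul_zetaTailPMF {γ : ℝ} (hγ : 1 < γ) :
    Summable fun k : ℕ => (k : ℝ) * zetaTailPMF γ k := by
  have hsum : Summable fun k : ℕ => ((k : ℝ) + 2) ^ (-γ) := by
    have := (summable_nat_add_iff 2).2 (Real.summable_nat_rpow.2 (by linarith : -γ < -1))
    simpa using this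
  have htele : ∀ N : ℕ, ∑ k ∈ Finset.range N, (k : ℝ) * zetaTailPMF γ k
      = ∑ k ∈ Finset.range N, ((k : ℝ) + 2) ^ (-γ) - N * ((N : ℝ) + 1) ^ (-γ) := by
    intro N
    induction N with
    | zero => simp
    | succ N ih =>
      rw [Finset.sum_range_succ, Finset.sum_range_succ, ih, zetaTailPMF]
      push_cast
      rw [add_assoc (N : ℝ) 1 1, one_add_one_eq_two]
      ring
  refine summable_of_sum_range_le (c := ∑' k : ℕ, ((k : ℝ) + 2) ^ (-γ))
    (fun k => mul_nonneg k.cast_nonneg (zetaTailPMF_pos (by linarith) k).le) fun N => ?_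
  rw [htele]
  have h1 : ∑ k ∈ Finset.range N, ((k : ℝ) + 2) ^ (-γ) ≤ ∑' k : ℕ, ((k : ℝ) + 2) ^ (-γ) :=
    hsum.sum_le_tsum _ fun k _ => by positivity
  have h2 : 0 ≤ (N : ℝ) * ((N : ℝ) + 1) ^ (-γ) := by positivity
  linarith

/-- The mixture of `zetaTailPMF γ` with weight `c` and a point mass at one. -/
noncomputable def mixPMF (γ c : ℝ) (k : ℕ) : ℝ :=
  c * zetaTailPMF γ k + if k = 1 then 1 - c else 0

lemma mixPMF_pos {γ c : ℝ} (hγ : 0 < γ) (hc : 0 < c) (hc1 : c ≤ 1) (k : ℕ) :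
    0 < mixPMF γ c k := by
  have := mul_pos hc (zetaTailPMF_pos hγ k)
  unfold mixPMF
  split_ifs <;> linarith

lemma isPMF_mixPMF {γ c : ℝ} (hγ : 0 < γ) (hc : 0 < c) (hc1 : c ≤ 1) : IsPMF (mixPMF γ c) where
  nonneg k := (mixPMF_pos hγ hc hc1 k).le
  hasSum_one := by
    have h := ((hasSum_zetaTailPMF hγ).mul_left c).add (hasSum_ite_eq (1 : ℕ) (1 - c))
    rw [mul_one, add_sub_cancel] at h
    exact h

lemma hasSum_mul_mixPMF {γ : ℝ} (hγ : 1 < γ) (c : ℝ) :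
    HasSum (fun k : ℕ => (k : ℝ) * mixPMF γ c k)
      (c * (∑' k : ℕ, (k : ℝ) * zetaTailPMF γ k) + (1 - c)) := by
  have h := ((summable_mul_zetaTailPMF hγ).hasSum.mul_left c).add
    (hasSum_ite_eq (1 : ℕ) (1 - c))
  refine h.congr_fun fun k => ?_
  by_cases hk : k = 1
  · subst hk; simp [mixPMF]
  · simp only [mixPMF, hk, if_false]; ring

lemma one_sub_cumDist_mixPMF (γ c : ℝ) {x : ℝ} (hx : 1 ≤ x) :
    1 - cumDist (mixPMF γ c) x = c * ((⌊x⌋₊ : ℝ) + 2) ^ (-γ) := by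
  have h1 : 1 ≤ ⌊x⌋₊ := Nat.le_floor (by simpa using hx)
  have h2 : (1 : ℕ) ∈ Finset.range (⌊x⌋₊ + 1) := Finset.mem_range.2 (by omega)
  rw [cumDist, if_pos (by linarith)]
  simp only [mixPMF]
  rw [Finset.sum_add_distrib, ← Finset.mul_sum, sum_range_zetaTailPMF, Finset.sum_ite_eq',
    if_pos h2]
  push_cast
  rw [add_assoc (⌊x⌋₊ : ℝ) 1 1, one_add_one_eq_two]
  ring

lemma measurable_cumDist (f : ℕ → ℝ) : Measurable (cumDist f) := by
  unfold cumDist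
  exact Measurable.ite measurableSet_Ici
    ((measurable_from_nat (f := fun m => ∑ k ∈ Finset.range (m + 1), f k)).comp
      Nat.measurable_floor) measurable_const

lemma isSlowlyVarying_of_tendsto {ℓ : ℝ → ℝ} {c : ℝ} (hℓ : Measurable ℓ) (hc : 0 < c)
    (h : Tendsto ℓ atTop (𝓝 c)) : IsSlowlyVarying ℓ where
  measurable := hℓ
  eventually_pos := h.eventually (lt_mem_nhds hc)
  tendsto_ratio t ht := by
    have h1 : Tendsto (fun x => ℓ (t * x)) atTop (𝓝 c) :=
      h.comp (tendsto_id.const_mul_atTop ht)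
    have h2 := h1.div h hc.ne'
    rw [div_self hc.ne'] at h2
    exact h2

lemma hasRegularlyVaryingTail_mixPMF {γ c : ℝ} (hc : 0 < c) :
    HasRegularlyVaryingTail (mixPMF γ c) γ := by
  -- This `ℓ` makes the tail identity automatic; it is slowly varying because it converges to `c >
  -- 0`.
  refine ⟨fun x => (1 - cumDist (mixPMF γ c) x) * x ^ γ, ?_, fun x hx => ?_⟩
  · refine isSlowlyVarying_of_tendsto (c := c)
      ((measurable_const.sub (measurable_cumDist _)).mul
        (measurable_id.pow_const γ)) hc ?_
    have hfloor : Tendsto (fun x : ℝ => ((⌊x⌋₊ : ℝ) + 2) / x) atTop (𝓝 1) := by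
      have h1 := (tendsto_nat_floor_div_atTop (R := ℝ)).add
        (tendsto_const_nhds.div_atTop tendsto_id : Tendsto (fun x : ℝ => 2 / x) atTop (𝓝 0))
      simpa [add_div] using h1
    have hpow := (hfloor.rpow_const (p := -γ) (Or.inl one_ne_zero)).const_mul c
    rw [Real.one_rpow, mul_one] at hpow
    refine hpow.congr' ?_
    filter_upwards [eventually_ge_atTop 1] with x hx
    have hx0 : 0 ≤ x := by linarith
    rw [one_sub_cumDist_mixPMF γ c hx, Real.div_rpow (by positivity) hx0, Real.rpow_neg hx0,
      div_inv_eq_mul, mul_assoc]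
  · rw [mul_assoc, ← Real.rpow_add hx, add_neg_cancel, Real.rpow_zero, mul_one]

/-- There are regularly varying distributions with finite mean of which the size-biased version is
almost concentrated at one. -/
lemma exists_isSizeBiased_one_gt {γ δ : ℝ} (hγ : 1 < γ) (hδ : 0 < δ) :
    ∃ f fstar : ℕ → ℝ, IsPMF f ∧ IsPMF fstar ∧ (∀ k, 0 < f k) ∧ IsSizeBiased f fstar ∧
      HasRegularlyVaryingTail f γ ∧ 1 - δ ≤ fstar 1 ∧ f 0 ≤ 1 / 4 := by
  have hγ0 : 0 < γ := by linarith
  set M := ∑' k : ℕ, (k : ℝ) * zetaTailPMF γ k with hM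
  have hM0 : 0 ≤ M := tsum_nonneg fun k => mul_nonneg k.cast_nonneg (zetaTailPMF_pos hγ0 k).le
  -- With mean `m = c M + 1 - c`, the bound `1 - δ ≤ (1 - c) / m` amounts to `c M ≤ δ m`. The second
  -- entry gives `c M ≤ δ / 2`, the first gives `m ≥ 3 / 4` and also `f 0 ≤ 1 / 4`.
  set c := min (1 / 4) (δ / (2 * M + 1))
  have hc : 0 < c := lt_min (by norm_num) (by positivity)
  have hc4 : c ≤ 1 / 4 := min_le_left _ _
  have hcM : c * (2 * M + 1) ≤ δ := (le_div_iff₀ (by positivity)).1 (min_le_right _ _)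
  have hmean := hasSum_mul_mixPMF hγ c
  rw [← hM] at hmean
  set m := c * M + (1 - c)
  have hcM0 : 0 ≤ c * M := by positivity
  have hm : 3 / 4 ≤ m := by simp only [m]; linarith
  have hm0 : 0 < m := by linarith
  have hpos := mixPMF_pos hγ0 hc (by linarith)
  refine ⟨mixPMF γ c, fun k => (k : ℝ) * mixPMF γ c k / m, isPMF_mixPMF hγ0 hc (by linarith),
    ⟨fun k => div_nonneg (mul_nonneg k.cast_nonneg (hpos k).le) hm0.le, ?_⟩, hpos,
    ⟨m, hm0.ne', hmean, fun _ => rfl⟩, hasRegularlyVaryingTail_mixPMF hc, ?_, ?_⟩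
  · simpa [div_self hm0.ne'] using hmean.div_const m
  · have h1 : 0 < c * zetaTailPMF γ 1 := mul_pos hc (zetaTailPMF_pos hγ0 1)
    have h2 : 1 - c ≤ mixPMF γ c 1 := by simp only [mixPMF, if_true]; linarith
    rw [le_div_iff₀ hm0, Nat.cast_one, one_mul]
    refine le_trans ?_ h2
    have : c * M ≤ δ * m := by
      have := mul_le_mul_of_nonneg_left hm hδ.le
      nlinarith
    simp only [m] at this ⊢
    linarith
  · have h0 : 0 ≤ (2 : ℝ) ^ (-γ) := by positivity
    have : mixPMF γ c 0 = c * (1 - 2 ^ (-γ)) := by simp [mixPMF, zetaTailPMF]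
    rw [this]
    nlinarith

/-! ## Graphs close to the limiting distributions -/

lemma le_of_tsum_ofReal_le {a : ℕ → ℝ} {b : ℝ} (hb : 0 ≤ b)
    (h : ∑' k, ENNReal.ofReal |a k| ≤ ENNReal.ofReal b) (k : ℕ) : |a k| ≤ b :=
  (ENNReal.ofReal_le_ofReal_iff hb).1 ((ENNReal.le_tsum k).trans h)

lemma empSizeBiased_one_ge_of_mem_closeSet {f fstar : ℕ → ℝ} {ε : ℝ} {n : ℕ}
    {g : Multigraph n} (hg : g ∈ closeSet f fstar ε n) :
    fstar 1 - (n : ℝ) ^ (-ε) ≤ empSizeBiased g 1 := by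
  have h := le_of_tsum_ofReal_le (by positivity) ((le_max_right _ _).trans hg) 1
  linarith [(abs_le.1 h).1]

lemma empDegree_zero_le_of_mem_closeSet {f fstar : ℕ → ℝ} {ε : ℝ} {n : ℕ}
    {g : Multigraph n} (hg : g ∈ closeSet f fstar ε n) :
    empDegree g 0 ≤ f 0 + (n : ℝ) ^ (-ε) := by
  have h := le_of_tsum_ofReal_le (by positivity) ((le_max_left _ _).trans hg) 0
  simp only [zero_add, Finset.sum_range_one] at h
  linarith [(abs_le.1 h).2]

lemma mul_one_sub_empDegree_zero_le {n : ℕ} (g : Multigraph n) (hn : 0 < n) :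
    (n : ℝ) * (1 - empDegree g 0) ≤ totalDegree g := by
  have hn' : (n : ℝ) ≠ 0 := by exact_mod_cast hn.ne'
  have h1 : (n : ℝ) * (1 - empDegree g 0)
      = ∑ i, (1 - if degree g i = 0 then (1 : ℝ) else 0) := by
    rw [Finset.sum_sub_distrib, empDegree, mul_sub, ← mul_assoc, mul_one_div_cancel hn', one_mul]
    simp
  rw [h1, totalDegree, Nat.cast_sum]
  refine Finset.sum_le_sum fun i _ => ?_
  split_ifs with h
  · simp
  · rw [sub_zero]; exact_mod_cast Nat.pos_of_ne_zero h

/-- At most half of the nodes are isolated, and each other node adds at least one to the total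
degree. -/
lemma half_le_totalDegree_of_mem_closeSet {f fstar : ℕ → ℝ} {ε : ℝ} {n : ℕ}
    {g : Multigraph n} (hg : g ∈ closeSet f fstar ε n) (hn : 0 < n) (hf : f 0 ≤ 1 / 4)
    (hε : (n : ℝ) ^ (-ε) ≤ 1 / 4) : (n : ℝ) / 2 ≤ totalDegree g := by
  have h1 := empDegree_zero_le_of_mem_closeSet hg
  refine le_trans ?_ (mul_one_sub_empDegree_zero_le g hn)
  nlinarith [(Nat.cast_nonneg n : (0 : ℝ) ≤ n)]

/-! ## Random graphs -/

/-- Conditioning on a countably valued random variable. -/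
lemma measureReal_mem_and_mem_le {Ω M E : Type*} [MeasurableSpace Ω] [MeasurableSpace M]
    [MeasurableSpace E] [Countable M] [MeasurableSingletonClass M] {P : Measure Ω}
    [IsProbabilityMeasure P] {G : Ω → M} {Y : Ω → E} (hG : Measurable G)
    (hind : IndepFun G Y P) (K : Set M) (B : M → Set E) (hB : ∀ g, MeasurableSet (B g)) {b : ℝ}
    (hb : 0 ≤ b) (hK : ∀ g ∈ K, P.real {ω | Y ω ∈ B g} ≤ b) :
    P.real {ω | G ω ∈ K ∧ Y ω ∈ B (G ω)} ≤ b := by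
  refine ENNReal.toReal_le_of_le_ofReal hb ?_
  have hsub : {ω | G ω ∈ K ∧ Y ω ∈ B (G ω)}
      ⊆ ⋃ g : K, (G ⁻¹' {(g : M)} ∩ Y ⁻¹' B g) := fun ω hω =>
    Set.mem_iUnion.2 ⟨⟨G ω, hω.1⟩, rfl, hω.2⟩
  have hdisj : Pairwise (Function.onFun Disjoint fun g : K => G ⁻¹' {(g : M)}) := by
    intro g g' hgg'
    refine Disjoint.preimage G (Set.disjoint_singleton.2 fun h => hgg' (Subtype.ext h))
  calc P {ω | G ω ∈ K ∧ Y ω ∈ B (G ω)}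
      ≤ ∑' g : K, P (G ⁻¹' {(g : M)} ∩ Y ⁻¹' B g) :=
        (measure_mono hsub).trans (measure_iUnion_le _)
    _ ≤ ∑' g : K, P (G ⁻¹' {(g : M)}) * ENNReal.ofReal b := by
        refine ENNReal.tsum_le_tsum fun g => ?_
        rw [hind.measure_inter_preimage_eq_mul _ _ (measurableSet_singleton _) (hB g)]
        gcongr
        exact (ENNReal.le_ofReal_iff_toReal_le (measure_ne_top _ _) hb).2 (hK g g.2)
    _ = P (⋃ g : K, G ⁻¹' {(g : M)}) * ENNReal.ofReal b := by
        rw [ENNReal.tsum_mul_right, measure_iUnion hdisj fun g => hG (measurableSet_singleton _)]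
    _ ≤ 1 * ENNReal.ofReal b := by gcongr; exact prob_le_one
    _ = ENNReal.ofReal b := one_mul _

/-- Subadditivity replaces the complement rule, so neither event has to be measurable. -/
lemma one_sub_le_measureReal_of_compl_subset {Ω : Type*} [MeasurableSpace Ω] {P : Measure Ω}
    [IsProbabilityMeasure P] {A B : Set Ω} (h : Aᶜ ⊆ B) : 1 - P.real B ≤ P.real A := by
  have h1 : P.real (A ∪ B) = 1 := by
    have hAB : A ∪ B = Set.univ := Set.eq_univ_of_forall fun ω => (em (ω ∈ A)).imp id fun hA => h hA
    rw [hAB, probReal_univ]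
  linarith [measureReal_union_le (μ := P) A B]

/-- Distinct arcs thus receive distinct tie-breakers, and independence passes from labels to the
arcs of a fixed graph. -/
lemma Arc.label_injective {n : ℕ} (g : Multigraph n) :
    Function.Injective (Arc.label : Arc g → ArcLabel n) := by
  rintro ⟨⟨i, j⟩, a⟩ ⟨⟨i', j'⟩, a'⟩ h
  simp only [Arc.label, Prod.mk.injEq] at h
  obtain ⟨rfl, rfl, h⟩ := h
  rw [Fin.ext h]

/-- The values of the tie-breaking variables for which few triples of arcs between nodes of degree
one are concordant. -/
def discordantSet {n : ℕ} (α : ℝ) (g : Multigraph n) :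
    Set (ArcLabel n ⊕ ArcLabel n → ℝ) :=
  {y | ∑ t ∈ unitArcs g ×ˢ unitArcs g ×ˢ unitArcs g,
    concord (fun i => y (Sum.map Arc.label Arc.label i)) t
      < (1 / 4 - α) * ((unitArcs g).card : ℝ) ^ 3}

lemma measurableSet_discordantSet {n : ℕ} (α : ℝ) (g : Multigraph n) :
    MeasurableSet (discordantSet α g) :=
  measurableSet_lt (Finset.measurable_sum _ fun t _ =>
    measurable_concord (fun _ => measurable_pi_apply _) t) measurable_const

lemma IsUniformTieBreaking.measureReal_discordantSet_le {n : ℕ} {Ω : Type*} [MeasurableSpace Ω]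
    {P : Measure Ω} [IsProbabilityMeasure P] {G : Ω → Multigraph n} {U W : ArcLabel n → Ω → ℝ}
    (h : IsUniformTieBreaking P G U W) (g : Multigraph n) (hg : 0 < (unitArcs g).card) {α : ℝ}
    (hα : 0 < α) :
    P.real {ω | (fun e => Sum.elim U W e ω) ∈ discordantSet α g}
      ≤ 9 / (α ^ 2 * (unitArcs g).card) := by
  have hmeas : ∀ e, Measurable (Sum.elim U W e) := by
    rintro (e | e)
    · exact h.measurable_left e
    · exact h.measurable_right e
  have hlaw : ∀ e, P.map (Sum.elim U W e) = volume.restrict (Set.Ioo (0 : ℝ) 1) := by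
    rintro (e | e)
    · exact h.uniform_left e
    · exact h.uniform_right e
  exact measureReal_sum_concord_lt_le (fun i => hmeas _)
    (h.indep.precomp (Sum.map_injective.2 ⟨Arc.label_injective g, Arc.label_injective g⟩))
    (fun i => hlaw _) (unitArcs g) hg hα

/-- The argument attains the rate `1 / n`, which `n ^ (-1 + κ)` dominates as `κ ≥ 0`; the middle
term is not needed. -/
lemma errorRate_ge {f fstar : ℕ → ℝ} {ε : ℝ} (hε : 0 < ε) {Ω : ℕ → Type*}
    [∀ n, MeasurableSpace (Ω n)] (P : ∀ n, Measure (Ω n)) (G : ∀ n, Ω n → Multigraph n) {n : ℕ}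
    (hn : 0 < n) :
    (n : ℝ)⁻¹ + (P n).real {ω | G n ω ∉ closeSet f fstar ε n} ≤ errorRate f fstar ε P G n := by
  have hn1 : (1 : ℝ) ≤ n := by exact_mod_cast hn
  have h1 : (n : ℝ)⁻¹ ≤ (n : ℝ) ^ (-1 + min ε (1 / 2)) := by
    rw [← Real.rpow_neg_one]
    exact Real.rpow_le_rpow_of_exponent_le hn1
      (le_add_of_nonneg_right (le_min hε.le (by norm_num)))
  have h2 : 0 ≤ (n : ℝ) ^ (-ε + 3 * min ε (1 / 2) / 4) := by positivity
  unfold errorRate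
  linarith

end SpearmanGraph

/-! ### The two probability bounds -/

open SpearmanGraph
theorem mainTheorem5 (ρ γ : ℝ) (hρ : -1 < ρ) (hρ' : ρ < 0) (hγ : 1 < γ) :
    ∃ f fstar : ℕ → ℝ,
      IsPMF f ∧ IsPMF fstar ∧ (∀ k, 0 < f k) ∧ IsSizeBiased f fstar ∧
      HasRegularlyVaryingTail f γ ∧
      ∀ (η ε : ℝ) (Ω : ℕ → Type*) [∀ n, MeasurableSpace (Ω n)]
        (P : ∀ n, Measure (Ω n)) [∀ n, IsProbabilityMeasure (P n)]
        (G : ∀ n, Ω n → Multigraph n),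
        InGraphClass η ε f fstar P G →
          (∃ C : ℝ, ∀ᶠ n : ℕ in atTop,
            (P n).real {ω | rhoTilde (G n ω) > ρ} ≥ 1 - C * errorRate f fstar ε P G n) ∧
          ∀ U W : ∀ n, ArcLabel n → Ω n → ℝ,
            (∀ n, IsUniformTieBreaking (P n) (G n) (U n) (W n)) →
              ∃ C : ℝ, ∀ᶠ n : ℕ in atTop,
                (P n).real {ω | rho (G n ω) (fun e => U n e.label ω) (fun e => W n e.label ω) > ρ}
                  ≥ 1 - C * errorRate f fstar ε P G n := by
  -- This is the tolerance `r / 100` of `rho_gt` with `r = -ρ`; it also suffices for `rhoTilde_ge`,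
  -- whose loss is about `12 α`.
  set α := -ρ / 100 with hα_def
  have hα : 0 < α := by simp only [hα_def]; linarith
  have hα1 : α < 1 / 100 := by simp only [hα_def]; linarith
  -- Half of `α` is spent on `fstar 1`, the other half on the deviation `n ^ (-ε)`.
  obtain ⟨f, fstar, hf, hfstar, hpos, hbias, htail, hone, hzero⟩ :=
    exists_isSizeBiased_one_gt hγ (half_pos hα)
  refine ⟨f, fstar, hf, hfstar, hpos, hbias, htail, ?_⟩
  intro η ε Ω _ P _ G hG
  -- Since `L_n ≥ n / 2`, the threshold `40 / -ρ` on `n` yields the threshold `20 / r` on `L_n` in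
  -- `rho_gt`.
  have hclose : ∀ᶠ n : ℕ in atTop, 0 < n ∧ 40 / -ρ < n ∧ ∀ g ∈ closeSet f fstar ε n,
      (n : ℝ) / 2 ≤ totalDegree g ∧ 0 < totalDegree g ∧ 1 - α ≤ empSizeBiased g 1 := by
    have hrate : Tendsto (fun n : ℕ => (n : ℝ) ^ (-ε)) atTop (𝓝 0) :=
      (tendsto_rpow_neg_atTop hG.eps_pos).comp tendsto_natCast_atTop_atTop
    filter_upwards [hrate.eventually (gt_mem_nhds (half_pos hα)), eventually_gt_atTop 0,
      tendsto_natCast_atTop_atTop.eventually (eventually_gt_atTop (40 / -ρ))] with n h1 h2 h3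
    refine ⟨h2, h3, fun g hg => ?_⟩
    have hL := half_le_totalDegree_of_mem_closeSet hg h2 hzero (by linarith)
    have hn : (0 : ℝ) < n := by exact_mod_cast h2
    refine ⟨hL, by exact_mod_cast (by linarith : (0 : ℝ) < totalDegree g), ?_⟩
    linarith [empSizeBiased_one_ge_of_mem_closeSet hg]
  -- For `rhoTilde` only `Ω_n^c` is lost. For `rho` there is also the Chebyshev bound `9 / (α ^ 2
  -- |S|)` with `|S| ≥ n / 4`, whence `36 / α ^ 2`.
  refine ⟨⟨1, ?_⟩, fun U W hUW => ⟨36 / α ^ 2 + 1, ?_⟩⟩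
  · filter_upwards [hclose] with n ⟨hn, _, hn'⟩
    have hsub : {ω | rhoTilde (G n ω) > ρ}ᶜ ⊆ {ω | G n ω ∉ closeSet f fstar ε n} := by
      intro ω hω hmem
      obtain ⟨-, hL, hs⟩ := hn' _ hmem
      refine hω (lt_of_lt_of_le ?_ (rhoTilde_ge (G n ω) hL (by linarith) hs))
      have : ρ = -100 * α := by simp only [hα_def]; ring
      rw [this]
      nlinarith [mul_pos hα hα, mul_pos (mul_pos hα hα) hα]
    have h1 := one_sub_le_measureReal_of_compl_subset (P := P n) hsub
    have h2 := errorRate_ge (f := f) (fstar := fstar) hG.eps_pos P G hn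
    have h3 : (0 : ℝ) ≤ (n : ℝ)⁻¹ := by positivity
    linarith
  · filter_upwards [hclose] with n ⟨hn, hn40, hn'⟩
    have hn0 : (0 : ℝ) < n := by exact_mod_cast hn
    have hcard : ∀ g ∈ closeSet f fstar ε n, (n : ℝ) / 4 ≤ (unitArcs g).card := by
      intro g hg
      obtain ⟨hL, hL0, hs⟩ := hn' g hg
      refine le_trans ?_ (le_card_unitArcs g hL0)
      nlinarith
    have hbad : (P n).real {ω | G n ω ∈ closeSet f fstar ε n ∧
        (fun e => Sum.elim (U n) (W n) e ω) ∈ discordantSet α (G n ω)}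
        ≤ 36 / α ^ 2 * (n : ℝ)⁻¹ := by
      refine measureReal_mem_and_mem_le (hG.measurable n) (hUW n).indep_graph _ _
        (measurableSet_discordantSet α) (by positivity) fun g hg => ?_
      have hc := hcard g hg
      have hc0 : (0 : ℝ) < (unitArcs g).card := by linarith
      refine ((hUW n).measureReal_discordantSet_le g (by exact_mod_cast hc0) hα).trans ?_
      calc 9 / (α ^ 2 * (unitArcs g).card) ≤ 9 / (α ^ 2 * ((n : ℝ) / 4)) := by gcongr
        _ = 36 / α ^ 2 * (n : ℝ)⁻¹ := by field_simp; norm_num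
    have hsub : {ω | rho (G n ω) (fun e => U n e.label ω) (fun e => W n e.label ω) > ρ}ᶜ
        ⊆ {ω | G n ω ∉ closeSet f fstar ε n} ∪ {ω | G n ω ∈ closeSet f fstar ε n ∧
          (fun e => Sum.elim (U n) (W n) e ω) ∈ discordantSet α (G n ω)} := by
      intro ω hω
      by_cases hmem : G n ω ∈ closeSet f fstar ε n
      · refine Or.inr ⟨hmem, ?_⟩
        by_contra hdis
        obtain ⟨hL, -, hs⟩ := hn' _ hmem
        have hL' : 20 / -ρ < (totalDegree (G n ω) : ℝ) := by
          refine lt_of_lt_of_le ?_ hL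
          have : 40 / -ρ = 2 * (20 / -ρ) := by ring
          linarith
        have := rho_gt (G n ω) (fun e => U n e.label ω) (fun e => W n e.label ω)
          (by linarith : 0 < -ρ) (by linarith) hL' hs (not_lt.1 hdis)
        rw [neg_neg] at this
        exact hω this
      · exact Or.inl hmem
    have h1 := one_sub_le_measureReal_of_compl_subset (P := P n) hsub
    have h2 := measureReal_union_le (μ := P n) {ω | G n ω ∉ closeSet f fstar ε n}
      {ω | G n ω ∈ closeSet f fstar ε n ∧
          (fun e => Sum.elim (U n) (W n) e ω) ∈ discordantSet α (G n ω)}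
    have h3 := errorRate_ge (f := f) (fstar := fstar) hG.eps_pos P G hn
    have h4 : 0 ≤ (n : ℝ)⁻¹ := by positivity
    have h5 : 0 ≤ 36 / α ^ 2 := by positivity
    have h6 : (0 : ℝ) ≤ (P n).real {ω | G n ω ∉ closeSet f fstar ε n} := measureReal_nonneg
    have h7 := mul_le_mul_of_nonneg_left h3 (by linarith : 0 ≤ 36 / α ^ 2 + 1)
    have h8 := mul_nonneg h5 h6
    linarith
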